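/- Let $K$ be a finite connected (in particular non-empty) abstract simplicial complex, and let $G$ be a subgroup of the group $\mathrm{aut}(K)$ of all simplicial automorphisms of $K$. Then there is a finite abstract simplicial complex $L$ such that: (i) $\mathrm{aut}(L) \cong G$ as groups; (ii) the geometric realization $|L|$ is homotopy equivalent to the geometric realization $|K|$. -/

import Mathlib

namespace AbstractSimplicialComplex

/-- The full automorphism group of an abstract simplicial complex `K` with vertex set `V`:
the bijections `σ` of the vertex set such that a finite set of vertices is a simplex
if and only if its image under `σ` is one. -/
def aut {V : Type*} (K : AbstractSimplicialComplex V) : Subgroup (Equiv.Perm V) where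
  carrier := {σ | ∀ s : Finset V, s.map σ.toEmbedding ∈ K.faces ↔ s ∈ K.faces}
  mul_mem' := by
    intro σ τ hσ hτ s
    have h : s.map (σ * τ).toEmbedding = (s.map τ.toEmbedding).map σ.toEmbedding := by
      rw [Finset.map_map]; rfl
    rw [h, hσ, hτ]
  one_mem' := by
    intro s
    have h : s.map (1 : Equiv.Perm V).toEmbedding = s := Finset.map_refl
    rw [h]
  inv_mem' := by
    intro σ hσ s
    have h : (s.map (σ⁻¹).toEmbedding).map σ.toEmbedding = s := by
      rw [Finset.map_map]
      exact (congrArg (fun e : Equiv.Perm V => s.map e.toEmbedding)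
        (mul_inv_cancel σ)).trans Finset.map_refl
    rw [← hσ, h]

/-- The graph formed by the vertices and the edges (1-simplices) of `K`. -/
def edgeGraph {V : Type*} (K : AbstractSimplicialComplex V) : SimpleGraph V where
  Adj v w := ∃ s ∈ K.faces, s.card = 2 ∧ v ∈ s ∧ w ∈ s ∧ v ≠ w
  symm := ⟨fun _ _ ⟨s, hs, h2, hv, hw, hne⟩ => ⟨s, hs, h2, hw, hv, hne.symm⟩⟩
  loopless := ⟨fun _ ⟨_, _, _, _, _, hne⟩ => hne rfl⟩

/-- A simplicial complex is connected if it has a vertex and any two of its vertices are joined by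
a path of edges. -/
def IsConnected {V : Type*} (K : AbstractSimplicialComplex V) : Prop :=
  K.edgeGraph.Connected

/-- The geometric realization of a finite simplicial complex `K` with vertex set `V`, in barycentric
coordinates: the points of the standard simplex in `ℝ^V` that are supported on a simplex of `K`,
with the topology inherited from `ℝ^V`. -/
def realization {V : Type*} [Fintype V] (K : AbstractSimplicialComplex V) : Set (V → ℝ) :=
  {x | x ∈ stdSimplex ℝ V ∧ ∃ s ∈ K.faces, ∀ v, x v ≠ 0 → v ∈ s}

end AbstractSimplicialComplex

namespace AbstractSimplicialComplex

/-! Attaching a cone to a complex at its apex changes the automorphisms but not the homotopy type: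
collapsing the cone to the apex is contiguous to the identity
(`nonempty_homotopyEquiv_of_retraction`). This makes it possible to realize any finite group `G`, in
two rounds of attaching cones.

The first round works with colored vertices. `cayleyAttach` glues to one vertex of `K` a cone over
triangles `{b h, a g, c (g * h)}` that record the multiplication table of `G`. Every vertex of `K`
and every `b h` gets its own color, the `a g` share one color and the `c g` another. A
color-preserving automorphism then commutes with right multiplications, so it is a left
multiplication (`colorAut_cayleyAttach`).

The second round removes the colors. `coneAttach` puts at each vertex a cone over a complex that
depends on the color. These complexes have no nontrivial automorphisms and are pairwise
non-isomorphic (`antiregular_rigid`), so the automorphisms of the result are exactly the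
color-preserving ones (`aut_coneAttach_eq_map`). -/

theorem mem_faces_of_subset {V : Type*} {K : AbstractSimplicialComplex V} {s t : Finset V}
    (hs : s ∈ K.faces) (hts : t ⊆ s) (ht : t.Nonempty) : t ∈ K.faces :=
  (K.isRelLowerSet_faces hs).2 hts ht

theorem nonempty_of_mem_faces {V : Type*} {K : AbstractSimplicialComplex V} {s : Finset V}
    (hs : s ∈ K.faces) : s.Nonempty :=
  (K.isRelLowerSet_faces hs).1

theorem map_mem_faces_of_mem_aut {V : Type*} {K : AbstractSimplicialComplex V} {σ : Equiv.Perm V}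
    (hσ : σ ∈ K.aut) (s : Finset V) : s.map σ.toEmbedding ∈ K.faces ↔ s ∈ K.faces :=
  hσ s

theorem mem_aut_of_forall {V : Type*} {K : AbstractSimplicialComplex V} {σ : Equiv.Perm V}
    (h : ∀ s ∈ K.faces, s.map σ.toEmbedding ∈ K.faces)
    (h' : ∀ s ∈ K.faces, s.map (σ⁻¹).toEmbedding ∈ K.faces) : σ ∈ K.aut := by
  intro s
  refine ⟨fun hs => ?_, h s⟩
  have := h' _ hs
  rw [Finset.map_map] at this
  exact (congrArg (· ∈ K.faces) ((congrArg (fun e : Equiv.Perm V => s.map e.toEmbedding)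
    (inv_mul_cancel σ)).trans Finset.map_refl)).mp this

/-! ### Contiguity and homotopy equivalence of realizations -/

section Realization

variable {V W : Type*} [Fintype V]

/-- The linear extension of a vertex map, in barycentric coordinates. -/
def pushforward [DecidableEq W] (f : V → W) (x : V → ℝ) : W → ℝ :=
  fun w => ∑ v, if f v = w then x v else 0

theorem continuous_pushforward [DecidableEq W] (f : V → W) : Continuous (pushforward f) := by
  unfold pushforward
  refine continuous_pi fun w => continuous_finsetSum _ fun v _ => ?_
  split_ifs
  · exact continuous_apply v
  · exact continuous_const

theorem pushforward_mem_stdSimplex [Fintype W] [DecidableEq W] (f : V → W) {x : V → ℝ} (hx : x ∈ stdSimplex ℝ V) :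
    pushforward f x ∈ stdSimplex ℝ W := by
  refine ⟨fun w => Finset.sum_nonneg fun v _ => ?_, ?_⟩
  · split_ifs
    · exact hx.1 v
    · exact le_rfl
  · unfold pushforward
    rw [Finset.sum_comm, ← hx.2]
    simp

theorem mem_image_of_pushforward_ne_zero [DecidableEq W] {f : V → W} {x : V → ℝ} {s : Finset V}
    (hs : ∀ v, x v ≠ 0 → v ∈ s) {w : W} (hw : pushforward f x w ≠ 0) : w ∈ s.image f := by
  obtain ⟨v, -, hv⟩ := Finset.exists_ne_zero_of_sum_ne_zero hw
  split_ifs at hv with h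
  · exact Finset.mem_image.2 ⟨v, hs v hv, h⟩
  · exact absurd rfl hv

theorem pushforward_pushforward_of_leftInverse [Fintype W] [DecidableEq V]
    [DecidableEq W] {f : V → W} {g : W → V}
    (h : Function.LeftInverse g f) (x : V → ℝ) : pushforward g (pushforward f x) = x := by
  funext v
  unfold pushforward
  simp only [← Finset.sum_filter]
  rw [← Finset.sum_biUnion]
  · refine (Finset.sum_eq_single v ?_ ?_)
    · intro b hb hbv
      simp only [Finset.mem_biUnion, Finset.mem_filter, Finset.mem_univ, true_and] at hb
      obtain ⟨a, ha, hab⟩ := hb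
      exact absurd (by rw [← ha, ← hab, h b]) hbv
    · intro hv
      exact absurd (by simp [h v]) hv
  · intro a _ b _ hab
    rw [Function.onFun, Finset.disjoint_left]
    intro c hc hc'
    simp only [Finset.mem_filter, Finset.mem_univ, true_and] at hc hc'
    exact hab (hc.symm.trans hc')

/-- The map of realizations induced by a simplicial map. -/
def realizationMap [Fintype W] [DecidableEq W] {K : AbstractSimplicialComplex V} {L : AbstractSimplicialComplex W}
    (f : V → W) (hf : ∀ s ∈ K.faces, s.image f ∈ L.faces) : C(K.realization, L.realization) where
  toFun x := ⟨pushforward f x.1, pushforward_mem_stdSimplex f x.2.1, by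
    obtain ⟨s, hs, h⟩ := x.2.2
    exact ⟨_, hf s hs, fun _ => mem_image_of_pushforward_ne_zero h⟩⟩
  continuous_toFun := ((continuous_pushforward f).comp continuous_subtype_val).subtype_mk _

/-- Maps into a realization which pointwise share a closed simplex are homotopic. -/
theorem homotopic_of_common_face [Fintype W] {X : Type*} [TopologicalSpace X]
    {L : AbstractSimplicialComplex W} (f g : C(X, L.realization))
    (h : ∀ x, ∃ s ∈ L.faces, ∀ w, (f x).1 w ≠ 0 ∨ (g x).1 w ≠ 0 → w ∈ s) :
    f.Homotopic g := by
  refine ⟨⟨⟨fun p => ⟨fun w => (1 - (p.1 : ℝ)) * (f p.2).1 w + (p.1 : ℝ) * (g p.2).1 w, ?_, ?_⟩,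
    ?_⟩, ?_, ?_⟩⟩
  · exact convex_stdSimplex ℝ W (f p.2).2.1 (g p.2).2.1 (sub_nonneg.2 p.1.2.2) p.1.2.1
      (sub_add_cancel _ _)
  · obtain ⟨s, hs, hw⟩ := h p.2
    refine ⟨s, hs, fun w hne => hw w ?_⟩
    by_contra! h0
    simp [h0.1, h0.2] at hne
  · refine Continuous.subtype_mk (continuous_pi fun w => ?_) _
    have hf : Continuous fun p : unitInterval × X => (f p.2).1 w :=
      (continuous_apply w).comp (continuous_subtype_val.comp (f.continuous.comp continuous_snd))
    have hg : Continuous fun p : unitInterval × X => (g p.2).1 w :=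
      (continuous_apply w).comp (continuous_subtype_val.comp (g.continuous.comp continuous_snd))
    have ht : Continuous fun p : unitInterval × X => (p.1 : ℝ) :=
      continuous_subtype_val.comp continuous_fst
    exact ((continuous_const.sub ht).mul hf).add (ht.mul hg)
  · intro x
    ext w
    simp
  · intro x
    ext w
    simp

/-- A simplicial retraction `p` onto `K`, with section `i`, such that `i ∘ p` is contiguous to the
identity of `L`, induces a homotopy equivalence of realizations. -/
theorem nonempty_homotopyEquiv_of_retraction [Fintype W] [DecidableEq V] [DecidableEq W]
    {K : AbstractSimplicialComplex V}
    {L : AbstractSimplicialComplex W} (p : W → V) (i : V → W) (hpi : Function.LeftInverse p i)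
    (hp : ∀ s ∈ L.faces, s.image p ∈ K.faces) (hi : ∀ s ∈ K.faces, s.image i ∈ L.faces)
    (hc : ∀ s ∈ L.faces, s ∪ (s.image p).image i ∈ L.faces) :
    Nonempty (ContinuousMap.HomotopyEquiv L.realization K.realization) := by
  refine ⟨⟨realizationMap p hp, realizationMap i hi, ?_, ?_⟩⟩
  · refine homotopic_of_common_face _ _ fun x => ?_
    obtain ⟨s, hs, h⟩ := x.2.2
    refine ⟨_, hc s hs, fun w hw => ?_⟩
    rcases hw with hw | hw
    · exact Finset.mem_union_right _ (mem_image_of_pushforward_ne_zero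
        (fun v hv => mem_image_of_pushforward_ne_zero h hv) hw)
    · exact Finset.mem_union_left _ (h w hw)
  · have : (realizationMap p hp).comp (realizationMap i hi) =
        ContinuousMap.id K.realization := by
      ext1 x
      exact Subtype.ext (pushforward_pushforward_of_leftInverse hpi x.1)
    rw [this]

end Realization

/-! ### A family of rigid, pairwise non-isomorphic complexes -/

/-- The antiregular graph on `{0, …, 2m}`, in which `i` and `j` are adjacent if `i + j > 2m`,
together with the full simplex on `{m + 1, …, m + 3 + c}`. -/
def antiregular (m c : ℕ) : AbstractSimplicialComplex (Fin (2 * m + 1)) where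
  faces := {s | s.Nonempty ∧ (∀ i ∈ s, ∀ j ∈ s, i ≠ j → 2 * m + 1 ≤ i.val + j.val) ∧
    (s.card ≤ 2 ∨ ∀ i ∈ s, m < i.val ∧ i.val ≤ m + 3 + c)}
  isRelLowerSet_faces := by
    rintro s ⟨hs, h1, h2⟩
    refine ⟨hs, fun t hts ht => ⟨ht, fun i hi j hj => h1 i (hts hi) j (hts hj), ?_⟩⟩
    exact h2.imp (fun h => (Finset.card_le_card hts).trans h) (fun h i hi => h i (hts hi))
  singleton_mem i := by
    refine ⟨Finset.singleton_nonempty i, fun a ha b hb hab => ?_, Or.inl (by simp)⟩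
    rw [Finset.mem_singleton] at ha hb
    exact absurd (ha.trans hb.symm) hab

theorem pair_mem_antiregular_iff {m c : ℕ} {i j : Fin (2 * m + 1)} :
    ({i, j} : Finset (Fin (2 * m + 1))) ∈ (antiregular m c).faces ↔
      i = j ∨ 2 * m + 1 ≤ i.val + j.val := by
  constructor
  · rintro ⟨-, h, -⟩
    by_cases hij : i = j
    · exact Or.inl hij
    · exact Or.inr (h i (by simp) j (by simp) hij)
  · intro h
    refine ⟨by simp, fun a ha b hb hab => ?_, Or.inl Finset.card_le_two⟩
    simp only [Finset.mem_insert, Finset.mem_singleton] at ha hb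
    grind

/-- The vertex `0` is isolated. That no vertex is joined to all others is what later separates cone
bases from apexes. -/
theorem exists_pair_notMem_antiregular {m c : ℕ} (hm : 0 < m) (i : Fin (2 * m + 1)) :
    ∃ j, ({i, j} : Finset (Fin (2 * m + 1))) ∉ (antiregular m c).faces := by
  simp only [pair_mem_antiregular_iff, Fin.ext_iff]
  by_cases hi : i.val = 0
  · exact ⟨⟨1, by omega⟩, by simp only; omega⟩
  · exact ⟨⟨0, by omega⟩, by simp only; omega⟩

/-- The `j` with `i + j > 2m` form the interval `[2m + 1 - i, 2m]`, which already contains `i`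
exactly when `i > m`. Hence the star sizes are all distinct, except that `m` and `m + 1` both give
`m + 1`. -/
theorem card_star_antiregular {m : ℕ} (i : Fin (2 * m + 1)) :
    (Finset.univ.filter fun j : Fin (2 * m + 1) => i = j ∨ 2 * m + 1 ≤ i.val + j.val).card =
      if m < i.val then i.val else i.val + 1 := by
  have h : ((Finset.univ.filter fun j : Fin (2 * m + 1) =>
      i = j ∨ 2 * m + 1 ≤ i.val + j.val).map Fin.valEmbedding) =
      insert i.val (Finset.Ico (2 * m + 1 - i.val) (2 * m + 1)) := by
    ext k
    simp only [Finset.mem_map, Finset.mem_filter, Finset.mem_univ, true_and,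
      Fin.valEmbedding_apply, Finset.mem_insert, Finset.mem_Ico]
    constructor
    · rintro ⟨j, hj | hj, rfl⟩
      · simp [hj]
      · omega
    · rintro (rfl | hk)
      · exact ⟨i, Or.inl rfl, rfl⟩
      · exact ⟨⟨k, hk.2⟩, Or.inr (by simp only; omega), rfl⟩
  rw [← Finset.card_map Fin.valEmbedding, h]
  split_ifs with hi
  · rw [Finset.insert_eq_of_mem (by simp only [Finset.mem_Ico]; omega), Nat.card_Ico]
    omega
  · rw [Finset.card_insert_of_notMem (by simp only [Finset.mem_Ico]; omega), Nat.card_Ico]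
    omega

/-- The added simplex has `c + 3 ≥ 3` vertices, so it cannot be a mere edge of the other complex and
must lie in that complex's added simplex. -/
theorem le_of_antiregular_le {m c c' : ℕ} (hc : c + 3 ≤ m)
    (h : (antiregular m c).faces ⊆ (antiregular m c').faces) : c ≤ c' := by
  have hs : (Finset.univ.filter fun i : Fin (2 * m + 1) => m < i.val ∧ i.val ≤ m + 3 + c) ∈
      (antiregular m c).faces := by
    refine ⟨⟨⟨m + 1, by omega⟩, by simp; omega⟩, fun i hi j hj _ => ?_, Or.inr (by simp)⟩
    simp only [Finset.mem_filter] at hi hj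
    omega
  obtain ⟨-, -, h'⟩ := h hs
  rcases h' with h' | h'
  · exfalso
    have : ({⟨m + 1, by omega⟩, ⟨m + 2, by omega⟩, ⟨m + 3, by omega⟩} :
        Finset (Fin (2 * m + 1))).card ≤ 2 :=
      (Finset.card_le_card (by intro x; simp; rintro (rfl | rfl | rfl) <;> simp <;> omega)).trans h'
    rw [Finset.card_eq_three.2 ⟨_, _, _, ?_, ?_, ?_, rfl⟩] at this <;> simp at *
  · have := h' ⟨m + 3 + c, by omega⟩ (by simp; omega)
    simp only at this
    omega

theorem antiregular_rigid {m c c' : ℕ} (hc : c + 3 ≤ m) (hc' : c' + 3 ≤ m)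
    (φ : Equiv.Perm (Fin (2 * m + 1)))
    (h : ∀ s : Finset (Fin (2 * m + 1)),
      s.map φ.toEmbedding ∈ (antiregular m c').faces ↔ s ∈ (antiregular m c).faces) :
    c = c' ∧ φ = 1 := by
  have hadj : ∀ i j, (φ i = φ j ∨ 2 * m + 1 ≤ (φ i).val + (φ j).val) ↔
      (i = j ∨ 2 * m + 1 ≤ i.val + j.val) := by
    intro i j
    rw [← pair_mem_antiregular_iff (c := c'), ← pair_mem_antiregular_iff (c := c), ← h]
    simp
  have hcard : ∀ i, (if m < (φ i).val then (φ i).val else (φ i).val + 1) =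
      if m < i.val then i.val else i.val + 1 := by
    intro i
    rw [← card_star_antiregular, ← card_star_antiregular]
    refine Eq.trans (congrArg Finset.card ?_) (Finset.card_map φ.toEmbedding)
    ext j
    obtain ⟨j, rfl⟩ := φ.surjective j
    simpa using hadj i j
  -- Star sizes leave only the swap of `m` and `m + 1` to exclude: `m + 1` lies in a triangle,
  -- whereas `m` lies in none.
  have htop : (φ ⟨m + 1, by omega⟩).val = m + 1 := by
    by_contra hne
    have h0 : (φ ⟨m + 1, by omega⟩).val = m := by
      have := hcard ⟨m + 1, by omega⟩
      simp only at this
      split_ifs at this <;> omega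
    have hs : ({⟨m + 1, by omega⟩, ⟨m + 2, by omega⟩, ⟨m + 3, by omega⟩} :
        Finset (Fin (2 * m + 1))) ∈ (antiregular m c).faces := by
      refine ⟨by simp, ?_, Or.inr ?_⟩
      · intro i hi j hj hij
        simp only [Finset.mem_insert, Finset.mem_singleton] at hi hj
        rcases hi with rfl | rfl | rfl <;> rcases hj with rfl | rfl | rfl <;>
          simp only at * <;> omega
      · intro i hi
        simp only [Finset.mem_insert, Finset.mem_singleton] at hi
        rcases hi with rfl | rfl | rfl <;> simp only <;> omega
    obtain ⟨-, -, h3⟩ := (h _).2 hs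
    rw [Finset.card_map, Finset.card_eq_three.2 ⟨_, _, _, ?_, ?_, ?_, rfl⟩] at h3
    · rcases h3 with h3 | h3
      · omega
      · have := h3 (φ ⟨m + 1, by omega⟩) (by simp)
        omega
    all_goals simp
  have hφ : φ = 1 := by
    ext i
    have hi := hcard i
    rw [Equiv.Perm.one_apply]
    by_contra hne
    have him : i.val ≠ m + 1 := by
      intro him
      exact hne (by rw [show i = ⟨m + 1, by omega⟩ from Fin.ext him, htop])
    have hi' : (φ i).val = m + 1 := by split_ifs at hi <;> omega
    exact him (congrArg Fin.val (φ.injective (Fin.ext (hi'.trans htop.symm))))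
  subst hφ
  have heq : ∀ s : Finset (Fin (2 * m + 1)),
      s ∈ (antiregular m c').faces ↔ s ∈ (antiregular m c).faces := by
    intro s
    rw [← h s, show s.map (1 : Equiv.Perm (Fin (2 * m + 1))).toEmbedding = s from
      Finset.map_refl]
  exact ⟨le_antisymm (le_of_antiregular_le hc fun s => (heq s).2)
    (le_of_antiregular_le hc' fun s => (heq s).1), rfl⟩

/-! ### Encoding a vertex coloring by attached cones -/

/-- The automorphisms of `K` preserving a coloring of the vertices. -/
def colorAut {V C : Type*} (K : AbstractSimplicialComplex V) (c : V → C) :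
    Subgroup (Equiv.Perm V) where
  carrier := {σ | σ ∈ K.aut ∧ ∀ v, c (σ v) = c v}
  mul_mem' := fun hσ hτ => ⟨mul_mem hσ.1 hτ.1, fun v => (hσ.2 _).trans (hτ.2 v)⟩
  one_mem' := ⟨one_mem _, fun _ => rfl⟩
  inv_mem' := fun {σ} hσ => ⟨inv_mem hσ.1, fun v =>
    (hσ.2 (σ⁻¹ v)).symm.trans (congrArg c (σ.apply_symm_apply v))⟩

theorem pair_map_mem_iff {V : Type*} [DecidableEq V] {K : AbstractSimplicialComplex V}
    {σ : Equiv.Perm V} (hσ : σ ∈ K.aut) (x y : V) :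
    ({σ x, σ y} : Finset V) ∈ K.faces ↔ ({x, y} : Finset V) ∈ K.faces := by
  rw [← map_mem_faces_of_mem_aut hσ {x, y}]
  simp

theorem card_star_apply {V : Type*} [Fintype V] [DecidableEq V] {K : AbstractSimplicialComplex V}
    [DecidablePred (· ∈ K.faces)] {σ : Equiv.Perm V} (hσ : σ ∈ K.aut) (x : V) :
    (Finset.univ.filter fun y => ({σ x, y} : Finset V) ∈ K.faces).card =
      (Finset.univ.filter fun y => ({x, y} : Finset V) ∈ K.faces).card := by
  refine Eq.trans (congrArg Finset.card ?_) (Finset.card_map σ.toEmbedding)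
  ext y
  obtain ⟨y, rfl⟩ := σ.surjective y
  rw [Finset.mem_map_equiv]
  simp [pair_map_mem_iff hσ]

/-- The complex obtained from `K` by attaching at every vertex `v` a cone over `Γ v` with apex
`v`. The vertex `v` becomes `(v, none)`. -/
def coneAttach {V F : Type*} (K : AbstractSimplicialComplex V)
    (Γ : V → AbstractSimplicialComplex F) : AbstractSimplicialComplex (V × Option F) where
  faces := {s | s.Nonempty ∧ ((∃ t ∈ K.faces, ∀ x ∈ s, x.2 = none ∧ x.1 ∈ t) ∨
    ∃ v, ∃ t ∈ (Γ v).faces, ∀ x ∈ s, x.1 = v ∧ ∀ f, x.2 = some f → f ∈ t)}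
  isRelLowerSet_faces := by
    rintro s ⟨hs, h⟩
    refine ⟨hs, fun t hts ht => ⟨ht, ?_⟩⟩
    rcases h with ⟨u, hu, h⟩ | ⟨v, u, hu, h⟩
    · exact Or.inl ⟨u, hu, fun x hx => h x (hts hx)⟩
    · exact Or.inr ⟨v, u, hu, fun x hx => h x (hts hx)⟩
  singleton_mem := by
    rintro ⟨v, _ | f⟩
    · exact ⟨by simp, Or.inl ⟨{v}, K.singleton_mem v, by simp⟩⟩
    · exact ⟨by simp, Or.inr ⟨v, {f}, (Γ v).singleton_mem f, by simp⟩⟩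

section ConeAttach

variable {V F : Type*} {K : AbstractSimplicialComplex V} {Γ : V → AbstractSimplicialComplex F}

/-- The first projection collapses each cone to its apex, and a face of a cone remains a face when
the apex is added. -/
theorem nonempty_homotopyEquiv_coneAttach [Fintype V] [Fintype F] :
    Nonempty (ContinuousMap.HomotopyEquiv (K.coneAttach Γ).realization K.realization) := by
  classical
  refine nonempty_homotopyEquiv_of_retraction Prod.fst (fun v => (v, none)) (fun _ => rfl) ?_ ?_ ?_
  · rintro s ⟨hs, ⟨t, ht, h⟩ | ⟨v, t, ht, h⟩⟩
    · refine mem_faces_of_subset ht ?_ (hs.image _)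
      intro v hv
      obtain ⟨x, hx, rfl⟩ := Finset.mem_image.1 hv
      exact (h x hx).2
    · refine mem_faces_of_subset (K.singleton_mem v) ?_ (hs.image _)
      intro w hw
      obtain ⟨x, hx, rfl⟩ := Finset.mem_image.1 hw
      exact Finset.mem_singleton.2 (h x hx).1
  · intro s hs
    refine ⟨(nonempty_of_mem_faces hs).image _, Or.inl ⟨s, hs, fun x hx => ?_⟩⟩
    obtain ⟨v, hv, rfl⟩ := Finset.mem_image.1 hx
    exact ⟨rfl, hv⟩
  · rintro s ⟨hs, h⟩
    refine ⟨hs.mono Finset.subset_union_left, ?_⟩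
    rcases h with ⟨t, ht, h⟩ | ⟨v, t, ht, h⟩
    · refine Or.inl ⟨t, ht, fun x hx => ?_⟩
      simp only [Finset.mem_union, Finset.mem_image] at hx
      rcases hx with hx | ⟨-, ⟨y, hy, rfl⟩, rfl⟩
      · exact h x hx
      · exact ⟨rfl, (h y hy).2⟩
    · refine Or.inr ⟨v, t, ht, fun x hx => ?_⟩
      simp only [Finset.mem_union, Finset.mem_image] at hx
      rcases hx with hx | ⟨-, ⟨y, hy, rfl⟩, rfl⟩
      · exact h x hx
      · exact ⟨(h y hy).1, by simp⟩

/-- The inclusion of the vertices of `K` in those of `K.coneAttach Γ`. -/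
def coneApex (V F : Type*) : V ↪ V × Option F :=
  ⟨fun v => (v, none), fun _ _ h => congrArg Prod.fst h⟩

/-- The inclusion of the vertices of `Γ v` in those of `K.coneAttach Γ`. -/
def coneBase {V : Type*} (F : Type*) (v : V) : F ↪ V × Option F :=
  ⟨fun f => (v, some f), fun _ _ h => Option.some_injective _ (congrArg Prod.snd h)⟩

theorem map_coneApex_mem_iff {s : Finset V} :
    s.map (coneApex V F) ∈ (K.coneAttach Γ).faces ↔ s ∈ K.faces := by
  constructor
  · rintro ⟨hs, ⟨t, ht, h⟩ | ⟨v, t, ht, h⟩⟩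
    · exact mem_faces_of_subset ht (fun v hv => (h _ (Finset.mem_map_of_mem _ hv)).2)
        (Finset.map_nonempty.1 hs)
    · exact mem_faces_of_subset (K.singleton_mem v)
        (fun w hw => Finset.mem_singleton.2 (h _ (Finset.mem_map_of_mem _ hw)).1)
        (Finset.map_nonempty.1 hs)
  · intro hs
    refine ⟨Finset.map_nonempty.2 (nonempty_of_mem_faces hs), Or.inl ⟨s, hs, fun x hx => ?_⟩⟩
    obtain ⟨v, hv, rfl⟩ := Finset.mem_map.1 hx
    exact ⟨rfl, hv⟩

theorem map_coneBase_mem_iff {v : V} {s : Finset F} :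
    s.map (coneBase F v) ∈ (K.coneAttach Γ).faces ↔ s ∈ (Γ v).faces := by
  constructor
  · rintro ⟨hs, ⟨t, ht, h⟩ | ⟨w, t, ht, h⟩⟩
    · obtain ⟨x, hx⟩ := Finset.map_nonempty.1 hs
      exact absurd (h _ (Finset.mem_map_of_mem _ hx)).1 (Option.some_ne_none x)
    · obtain ⟨x, hx⟩ := Finset.map_nonempty.1 hs
      obtain rfl : v = w := (h _ (Finset.mem_map_of_mem _ hx)).1
      exact mem_faces_of_subset ht (fun f hf => (h _ (Finset.mem_map_of_mem _ hf)).2 f rfl) ⟨x, hx⟩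
  · intro hs
    refine ⟨Finset.map_nonempty.2 (nonempty_of_mem_faces hs), Or.inr ⟨v, s, hs, fun x hx => ?_⟩⟩
    obtain ⟨f, hf, rfl⟩ := Finset.mem_map.1 hx
    exact ⟨rfl, fun g hg => Option.some_injective _ hg ▸ hf⟩

theorem pair_apex_mem_coneAttach [DecidableEq V] [DecidableEq F] (v : V) (o : Option F) :
    ({(v, none), (v, o)} : Finset (V × Option F)) ∈ (K.coneAttach Γ).faces := by
  rcases o with _ | f
  · simpa using (K.coneAttach Γ).singleton_mem (v, none)
  · exact ⟨by simp, Or.inr ⟨v, {f}, (Γ v).singleton_mem f, by simp⟩⟩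

theorem of_pair_base_mem_coneAttach [DecidableEq V] [DecidableEq F] {v : V} {f : F}
    {y : V × Option F}
    (h : ({(v, some f), y} : Finset (V × Option F)) ∈ (K.coneAttach Γ).faces) :
    y.1 = v ∧ ∀ g, y.2 = some g → ({f, g} : Finset F) ∈ (Γ v).faces := by
  obtain ⟨-, ⟨t, -, h⟩ | ⟨w, t, ht, h⟩⟩ := h
  · exact absurd (h _ (Finset.mem_insert_self _ _)).1 (Option.some_ne_none f)
  · have h1 := h (v, some f) (by simp)
    have h2 := h y (by simp)
    obtain rfl : v = w := h1.1
    refine ⟨h2.1, fun g hg => mem_faces_of_subset ht ?_ (by simp)⟩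
    intro a ha
    rcases Finset.mem_insert.1 ha with rfl | ha
    · exact h1.2 _ rfl
    · exact h2.2 _ (by rw [hg, Finset.mem_singleton.1 ha])

/-- The star of an apex contains all `|F| + 1` vertices of its cone. -/
theorem card_star_apex_coneAttach [Fintype V] [Fintype F] [DecidableEq V] [DecidableEq F]
    [DecidablePred (· ∈ (K.coneAttach Γ).faces)] (v : V) :
    Fintype.card F < (Finset.univ.filter fun y =>
      ({(v, none), y} : Finset (V × Option F)) ∈ (K.coneAttach Γ).faces).card := by
  have h : (Finset.univ.map ⟨fun o : Option F => (v, o), fun _ _ h => congrArg Prod.snd h⟩) ⊆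
      (Finset.univ.filter fun y =>
        ({(v, none), y} : Finset (V × Option F)) ∈ (K.coneAttach Γ).faces) := by
    intro y hy
    obtain ⟨o, -, rfl⟩ := Finset.mem_map.1 hy
    exact Finset.mem_filter.2 ⟨Finset.mem_univ _, pair_apex_mem_coneAttach v o⟩
  refine lt_of_lt_of_le ?_ (Finset.card_le_card h)
  rw [Finset.card_map, Finset.card_univ, Fintype.card_option]
  exact Nat.lt_succ_self _

/-- The star of a base vertex stays inside its own cone and misses at least the vertex given by `g`.
-/
theorem card_star_base_coneAttach [Fintype V] [Fintype F] [DecidableEq V] [DecidableEq F]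
    [DecidablePred (· ∈ (K.coneAttach Γ).faces)] {v : V} {f g : F}
    (hfg : ({f, g} : Finset F) ∉ (Γ v).faces) :
    (Finset.univ.filter fun y =>
      ({(v, some f), y} : Finset (V × Option F)) ∈ (K.coneAttach Γ).faces).card ≤
      Fintype.card F := by
  have h : (Finset.univ.filter fun y =>
      ({(v, some f), y} : Finset (V × Option F)) ∈ (K.coneAttach Γ).faces) ⊆
      ((Finset.univ.erase (some g)).map
        ⟨fun o : Option F => (v, o), fun _ _ h => congrArg Prod.snd h⟩) := by
    rintro ⟨w, o⟩ hy
    obtain ⟨h1, h2⟩ := of_pair_base_mem_coneAttach (Finset.mem_filter.1 hy).2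
    obtain rfl : w = v := h1
    exact Finset.mem_map_of_mem _
      (Finset.mem_erase.2 ⟨fun ho => hfg (h2 g ho), Finset.mem_univ _⟩)
  refine (Finset.card_le_card h).trans ?_
  rw [Finset.card_map, Finset.card_erase_of_mem (Finset.mem_univ _), Finset.card_univ,
    Fintype.card_option]
  exact le_rfl

theorem apply_snd_eq_none_iff_of_mem_aut_coneAttach [Fintype V] [Fintype F] [DecidableEq F]
    (hΓ : ∀ v f, ∃ g, ({f, g} : Finset F) ∉ (Γ v).faces) {σ : Equiv.Perm (V × Option F)}
    (hσ : σ ∈ (K.coneAttach Γ).aut) (x : V × Option F) : (σ x).2 = none ↔ x.2 = none := by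
  classical
  have key : ∀ y : V × Option F, y.2 = none ↔ Fintype.card F < (Finset.univ.filter fun z =>
      ({y, z} : Finset (V × Option F)) ∈ (K.coneAttach Γ).faces).card := by
    rintro ⟨v, _ | f⟩
    · exact iff_of_true rfl (card_star_apex_coneAttach v)
    · obtain ⟨g, hg⟩ := hΓ v f
      exact iff_of_false (Option.some_ne_none f) (card_star_base_coneAttach hg).not_gt
  rw [key, key, card_star_apply hσ]

/-- A permutation of `V` acting on `V × Option F` through the first factor. -/
def permFst (V F : Type*) : Equiv.Perm V →* Equiv.Perm (V × Option F) where
  toFun τ := τ.prodCongr (Equiv.refl _)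
  map_one' := rfl
  map_mul' _ _ := rfl

theorem permFst_injective : Function.Injective (permFst V F) := by
  intro σ τ h
  ext v
  exact congrArg Prod.fst (Equiv.congr_fun h (v, none))

variable {C : Type*} {c : V → C} {Δ : C → AbstractSimplicialComplex F}

theorem map_permFst_mem_coneAttach {τ : Equiv.Perm V} (hτ : τ ∈ K.colorAut c)
    {s : Finset (V × Option F)} (hs : s ∈ (K.coneAttach fun v => Δ (c v)).faces) :
    s.map (permFst V F τ).toEmbedding ∈ (K.coneAttach fun v => Δ (c v)).faces := by
  obtain ⟨hs, ⟨t, ht, h⟩ | ⟨v, t, ht, h⟩⟩ := hs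
  · refine ⟨Finset.map_nonempty.2 hs, Or.inl ⟨t.map τ.toEmbedding, (hτ.1 t).2 ht, fun x hx => ?_⟩⟩
    obtain ⟨y, hy, rfl⟩ := Finset.mem_map.1 hx
    exact ⟨(h y hy).1, Finset.mem_map_of_mem _ (h y hy).2⟩
  · refine ⟨Finset.map_nonempty.2 hs, Or.inr ⟨τ v, t, by simpa only [hτ.2] using ht, fun x hx => ?_⟩⟩
    obtain ⟨y, hy, rfl⟩ := Finset.mem_map.1 hx
    exact ⟨congrArg τ (h y hy).1, (h y hy).2⟩

theorem permFst_mem_aut_coneAttach {τ : Equiv.Perm V} (hτ : τ ∈ K.colorAut c) :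
    permFst V F τ ∈ (K.coneAttach fun v => Δ (c v)).aut := by
  refine mem_aut_of_forall (fun s hs => map_permFst_mem_coneAttach hτ hs) fun s hs => ?_
  rw [← map_inv]
  exact map_permFst_mem_coneAttach (inv_mem hτ) hs

/-- Attaching cones over pairwise non-isomorphic rigid complexes encodes a coloring. -/
theorem aut_coneAttach_eq_map [Finite V] [Finite F] [DecidableEq F]
    (hΔ : ∀ k f, ∃ g, ({f, g} : Finset F) ∉ (Δ k).faces)
    (hrigid : ∀ k k' (φ : Equiv.Perm F),
      (∀ s : Finset F, s.map φ.toEmbedding ∈ (Δ k').faces ↔ s ∈ (Δ k).faces) → k = k' ∧ φ = 1) :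
    (K.coneAttach fun v => Δ (c v)).aut = (K.colorAut c).map (permFst V F) := by
  classical
  have := Fintype.ofFinite V
  have := Fintype.ofFinite F
  refine le_antisymm (fun σ hσ => ?_) ?_
  swap
  · rintro _ ⟨τ, hτ, rfl⟩
    exact permFst_mem_aut_coneAttach hτ
  have hnone := apply_snd_eq_none_iff_of_mem_aut_coneAttach (fun v => hΔ (c v)) hσ
  have hapex : ∀ v, ∃ w, σ (v, none) = (w, none) := fun v =>
    ⟨_, Prod.ext rfl ((hnone (v, none)).2 rfl)⟩
  choose τ₀ hτ₀ using hapex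
  -- A base vertex is joined to its own apex, and a base vertex has no neighbor outside its cone; so
  -- its image lies over the image of the apex.
  have hbase : ∀ v f, ∃ g, σ (v, some f) = (τ₀ v, some g) := by
    intro v f
    obtain ⟨g, hg⟩ := Option.ne_none_iff_exists'.1
      (mt (hnone (v, some f)).1 (Option.some_ne_none f))
    have h := (pair_map_mem_iff hσ (v, none) (v, some f)).2 (pair_apex_mem_coneAttach v _)
    rw [hτ₀, Finset.pair_comm, show σ (v, some f) = ((σ (v, some f)).1, some g) from
      Prod.ext rfl hg] at h
    exact ⟨g, Prod.ext (of_pair_base_mem_coneAttach h).1.symm hg⟩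
  choose φ₀ hφ₀ using hbase
  have hτinj : Function.Injective τ₀ := fun v w h =>
    congrArg Prod.fst (σ.injective ((hτ₀ v).trans ((congrArg (·, none) h).trans (hτ₀ w).symm)))
  have hφinj : ∀ v, Function.Injective (φ₀ v) := fun v f g h =>
    Option.some_injective _ (congrArg Prod.snd (σ.injective
      ((hφ₀ v f).trans ((congrArg (fun a => (τ₀ v, some a)) h).trans (hφ₀ v g).symm))))
  let τ : Equiv.Perm V := Equiv.ofBijective τ₀ (Finite.injective_iff_bijective.1 hτinj)
  let φ : V → Equiv.Perm F := fun v =>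
    Equiv.ofBijective (φ₀ v) (Finite.injective_iff_bijective.1 (hφinj v))
  -- `σ` restricts to an isomorphism from the base over `v` to the base over `τ v`; rigidity then
  -- gives equal colors and the identity map.
  have hφ : ∀ v, c v = c (τ v) ∧ φ v = 1 := by
    refine fun v => hrigid _ _ _ fun s => ?_
    rw [← map_coneBase_mem_iff (K := K) (Γ := fun v => Δ (c v)) (v := v),
      ← map_coneBase_mem_iff (K := K) (Γ := fun v => Δ (c v)) (v := τ v),
      ← hσ (s.map (coneBase F v))]
    simp only [Finset.map_map]
    rw [show (φ v).toEmbedding.trans (coneBase F (τ v)) =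
      (coneBase F v).trans σ.toEmbedding from Function.Embedding.ext fun f => (hφ₀ v f).symm]
  refine ⟨τ, ⟨fun s => ?_, fun v => (hφ v).1.symm⟩, ?_⟩
  · rw [← map_coneApex_mem_iff (F := F) (K := K) (Γ := fun v => Δ (c v)) (s := s),
      ← map_coneApex_mem_iff (F := F) (K := K) (Γ := fun v => Δ (c v)),
      ← hσ (s.map (coneApex V F))]
    simp only [Finset.map_map]
    rw [show τ.toEmbedding.trans (coneApex V F) =
      (coneApex V F).trans σ.toEmbedding from Function.Embedding.ext fun v => (hτ₀ v).symm]
  · refine Equiv.ext ?_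
    rintro ⟨v, _ | f⟩
    · exact (hτ₀ v).symm
    · rw [hφ₀, show φ₀ v f = f from Equiv.congr_fun (hφ v).2 f]
      rfl

end ConeAttach

/-- Colorings can be removed without changing the automorphism group and the homotopy type. -/
theorem exists_aut_mulEquiv_colorAut {V C : Type} [Fintype V] [Finite C]
    (K : AbstractSimplicialComplex V) (c : V → C) :
    ∃ (W : Type) (_ : Fintype W) (L : AbstractSimplicialComplex W),
      Nonempty (L.aut ≃* K.colorAut c) ∧
      Nonempty (ContinuousMap.HomotopyEquiv L.realization K.realization) := by
  obtain ⟨n, ⟨e⟩⟩ := Finite.exists_equiv_fin C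
  -- With `n` colors, `m = n + 3` leaves room among the vertices above `m` for an added simplex of
  -- `k + 3` vertices for every `k < n`.
  have hle : ∀ k : C, (e k).val + 3 ≤ n + 3 := fun k => by omega
  refine ⟨V × Option (Fin (2 * (n + 3) + 1)), inferInstance,
    K.coneAttach fun v => antiregular (n + 3) (e (c v)), ⟨?_⟩, nonempty_homotopyEquiv_coneAttach⟩
  refine (MulEquiv.subgroupCongr (aut_coneAttach_eq_map (c := c)
    (Δ := fun k => antiregular (n + 3) (e k))
    (fun k f => exists_pair_notMem_antiregular (Nat.succ_pos _) f) fun k k' φ h => ?_)).trans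
    ((K.colorAut c).equivMapOfInjective _ permFst_injective).symm
  obtain ⟨h1, h2⟩ := antiregular_rigid (hle k) (hle k') φ h
  exact ⟨e.injective (Fin.ext h1), h2⟩

/-! ### Realizing a group by a colored complex -/

/-- The complex obtained from `K` by attaching at the vertex `v₀` a cone over the complex with
vertices `b h`, `a g`, `c g` (for `g h : G`) and facets `{b h, a g, c (g * h)}`. The vertices `v`
of `K`, `b h`, `a g` and `c g` are `inl (inl v)`, `inl (inr h)`, `inr (inl g)`, `inr (inr g)`. -/
def cayleyAttach {V : Type*} (G : Type*) [Group G] (K : AbstractSimplicialComplex V) (v₀ : V) :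
    AbstractSimplicialComplex ((V ⊕ G) ⊕ (G ⊕ G)) where
  faces := {s | s.Nonempty ∧ ((∃ t ∈ K.faces, ∀ x ∈ s, ∃ v ∈ t, x = Sum.inl (Sum.inl v)) ∨
    ∃ g h : G, ∀ x ∈ s, x = Sum.inl (Sum.inl v₀) ∨ x = Sum.inl (Sum.inr h) ∨
      x = Sum.inr (Sum.inl g) ∨ x = Sum.inr (Sum.inr (g * h)))}
  isRelLowerSet_faces := by
    rintro s ⟨hs, h⟩
    refine ⟨hs, fun t hts ht => ⟨ht, ?_⟩⟩
    rcases h with ⟨u, hu, h⟩ | ⟨g, k, h⟩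
    · exact Or.inl ⟨u, hu, fun x hx => h x (hts hx)⟩
    · exact Or.inr ⟨g, k, fun x hx => h x (hts hx)⟩
  singleton_mem := by
    rintro ((v | h) | (g | g))
    · exact ⟨by simp, Or.inl ⟨{v}, K.singleton_mem v, by simp⟩⟩
    · exact ⟨by simp, Or.inr ⟨1, h, by simp⟩⟩
    · exact ⟨by simp, Or.inr ⟨g, 1, by simp⟩⟩
    · exact ⟨by simp, Or.inr ⟨g, 1, by simp⟩⟩

/-- The coloring of the vertices of `K.cayleyAttach G v₀` whose only classes with more than one
element are the `a g` and the `c g`. -/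
def cayleyColor (V G : Type*) : (V ⊕ G) ⊕ (G ⊕ G) → (V ⊕ G) ⊕ Bool :=
  Sum.map id (Sum.elim (fun _ => false) (fun _ => true))

/-- The action of `G` on the vertices of `K.cayleyAttach G v₀` by left multiplication on the
`a g` and the `c g`. -/
def cayleyPerm (V G : Type*) [Group G] : G →* Equiv.Perm ((V ⊕ G) ⊕ (G ⊕ G)) where
  toFun g := Equiv.sumCongr (Equiv.refl _) (Equiv.sumCongr (Equiv.mulLeft g) (Equiv.mulLeft g))
  map_one' := by
    ext ((v | h) | (g | g)) <;> simp
  map_mul' a b := by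
    ext ((v | h) | (g | g)) <;> simp [mul_assoc]

section Cayley

variable {V G : Type*} [Group G]

theorem cayleyPerm_injective : Function.Injective (cayleyPerm V G) := by
  intro a b h
  simpa [cayleyPerm] using Equiv.congr_fun h (Sum.inr (Sum.inl 1))

variable {K : AbstractSimplicialComplex V} {v₀ : V}

theorem nonempty_homotopyEquiv_cayleyAttach [Fintype V] [Fintype G] :
    Nonempty (ContinuousMap.HomotopyEquiv (K.cayleyAttach G v₀).realization K.realization) := by
  classical
  refine nonempty_homotopyEquiv_of_retraction
    (Sum.elim (Sum.elim id fun _ => v₀) fun _ => v₀) (fun v => Sum.inl (Sum.inl v))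
    (fun _ => rfl) ?_ ?_ ?_
  · rintro s ⟨hs, ⟨t, ht, h⟩ | ⟨g, k, h⟩⟩
    · refine mem_faces_of_subset ht ?_ (hs.image _)
      intro v hv
      obtain ⟨x, hx, rfl⟩ := Finset.mem_image.1 hv
      obtain ⟨w, hw, rfl⟩ := h x hx
      exact hw
    · refine mem_faces_of_subset (K.singleton_mem v₀) ?_ (hs.image _)
      intro v hv
      obtain ⟨x, hx, rfl⟩ := Finset.mem_image.1 hv
      rcases h x hx with rfl | rfl | rfl | rfl <;> simp
  · intro s hs
    refine ⟨(nonempty_of_mem_faces hs).image _, Or.inl ⟨s, hs, fun x hx => ?_⟩⟩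
    obtain ⟨v, hv, rfl⟩ := Finset.mem_image.1 hx
    exact ⟨v, hv, rfl⟩
  · rintro s ⟨hs, h⟩
    refine ⟨hs.mono Finset.subset_union_left, ?_⟩
    rcases h with ⟨t, ht, h⟩ | ⟨g, k, h⟩
    · refine Or.inl ⟨t, ht, fun x hx => ?_⟩
      simp only [Finset.mem_union, Finset.mem_image] at hx
      rcases hx with hx | ⟨-, ⟨y, hy, rfl⟩, rfl⟩
      · exact h x hx
      · obtain ⟨w, hw, rfl⟩ := h y hy
        exact ⟨w, hw, rfl⟩
    · refine Or.inr ⟨g, k, fun x hx => ?_⟩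
      simp only [Finset.mem_union, Finset.mem_image] at hx
      rcases hx with hx | ⟨-, ⟨y, hy, rfl⟩, rfl⟩
      · exact h x hx
      · rcases h y hy with rfl | rfl | rfl | rfl <;> simp

theorem map_cayleyPerm_mem (a : G) {s : Finset ((V ⊕ G) ⊕ (G ⊕ G))}
    (hs : s ∈ (K.cayleyAttach G v₀).faces) :
    s.map (cayleyPerm V G a).toEmbedding ∈ (K.cayleyAttach G v₀).faces := by
  obtain ⟨hs, ⟨t, ht, h⟩ | ⟨g, k, h⟩⟩ := hs
  · refine ⟨Finset.map_nonempty.2 hs, Or.inl ⟨t, ht, fun x hx => ?_⟩⟩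
    obtain ⟨y, hy, rfl⟩ := Finset.mem_map.1 hx
    obtain ⟨v, hv, rfl⟩ := h y hy
    exact ⟨v, hv, rfl⟩
  · refine ⟨Finset.map_nonempty.2 hs, Or.inr ⟨a * g, k, fun x hx => ?_⟩⟩
    obtain ⟨y, hy, rfl⟩ := Finset.mem_map.1 hx
    rcases h y hy with rfl | rfl | rfl | rfl <;> simp [cayleyPerm, mul_assoc]

theorem cayleyPerm_mem_colorAut (a : G) :
    cayleyPerm V G a ∈ (K.cayleyAttach G v₀).colorAut (cayleyColor V G) := by
  refine ⟨mem_aut_of_forall (fun s hs => map_cayleyPerm_mem a hs) fun s hs => ?_, ?_⟩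
  · rw [← map_inv]
    exact map_cayleyPerm_mem _ hs
  · rintro ((v | h) | (g | g)) <;> rfl

theorem colorAut_cayleyAttach :
    (K.cayleyAttach G v₀).colorAut (cayleyColor V G) = (cayleyPerm V G).range := by
  classical
  refine le_antisymm ?_ ?_
  swap
  · rintro _ ⟨a, rfl⟩
    exact cayleyPerm_mem_colorAut a
  rintro σ ⟨hσ, hc⟩
  have hl : ∀ y, σ (Sum.inl y) = Sum.inl y := by
    intro y
    have h := hc (Sum.inl y)
    rcases hy : σ (Sum.inl y) with z | (z | z) <;> rw [hy] at h <;>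
      simp_all [cayleyColor]
  have ha : ∀ g, ∃ g', σ (Sum.inr (Sum.inl g)) = Sum.inr (Sum.inl g') := by
    intro g
    have h := hc (Sum.inr (Sum.inl g))
    rcases hy : σ (Sum.inr (Sum.inl g)) with z | (z | z) <;> rw [hy] at h <;>
      simp_all [cayleyColor]
  have hb : ∀ g, ∃ g', σ (Sum.inr (Sum.inr g)) = Sum.inr (Sum.inr g') := by
    intro g
    have h := hc (Sum.inr (Sum.inr g))
    rcases hy : σ (Sum.inr (Sum.inr g)) with z | (z | z) <;> rw [hy] at h <;>
      simp_all [cayleyColor]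
  choose α hα using ha
  choose γ hγ using hb
  -- The image of the triangle `{b h, a g, c (g * h)}` contains the fixed vertex `b h`, so it must
  -- be the triangle determined by `h` and `α g`.
  have key : ∀ g h, γ (g * h) = α g * h := by
    intro g h
    have hs : ({Sum.inl (Sum.inr h), Sum.inr (Sum.inl g), Sum.inr (Sum.inr (g * h))} :
        Finset ((V ⊕ G) ⊕ (G ⊕ G))) ∈ (K.cayleyAttach G v₀).faces :=
      ⟨by simp, Or.inr ⟨g, h, by simp⟩⟩
    rw [← map_mem_faces_of_mem_aut hσ] at hs
    obtain ⟨-, ⟨t, -, ht⟩ | ⟨g', h', ht⟩⟩ := hs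
    · simp [hl] at ht
    · simp only [Finset.map_insert, Finset.map_singleton, Equiv.coe_toEmbedding, hl, hα, hγ,
        Finset.mem_insert, Finset.mem_singleton, forall_eq_or_imp, forall_eq] at ht
      simp at ht
      rw [ht.2.2, ht.1, ht.2.1]
  -- Setting `h = 1` identifies the two permutations; then `g = 1` shows that both are left
  -- multiplication by `α 1`.
  have hγα : ∀ g, γ g = α g := fun g => by simpa using key g 1
  have hα1 : ∀ g, α g = α 1 * g := fun g => by simpa [hγα] using key 1 g
  refine ⟨α 1, Equiv.ext ?_⟩
  rintro (y | (g | g))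
  · exact (hl y).symm
  · rw [hα, hα1 g]; rfl
  · rw [hγ, hγα, hα1 g]; rfl

end Cayley

theorem exists_aut_mulEquiv_homotopyEquiv {V G : Type} [Fintype V] [Group G] [Finite G]
    (K : AbstractSimplicialComplex V) (v₀ : V) :
    ∃ (W : Type) (_ : Fintype W) (L : AbstractSimplicialComplex W),
      Nonempty (L.aut ≃* G) ∧
      Nonempty (ContinuousMap.HomotopyEquiv L.realization K.realization) := by
  have := Fintype.ofFinite G
  obtain ⟨W, _, L, ⟨e⟩, ⟨E⟩⟩ :=
    exists_aut_mulEquiv_colorAut (K.cayleyAttach G v₀) (cayleyColor V G)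
  obtain ⟨E'⟩ := nonempty_homotopyEquiv_cayleyAttach (G := G) (K := K) (v₀ := v₀)
  exact ⟨W, _, L, ⟨(e.trans (MulEquiv.subgroupCongr colorAut_cayleyAttach)).trans
    (MonoidHom.ofInjective cayleyPerm_injective).symm⟩, ⟨E.trans E'⟩⟩

/-! ### Change of universe and conclusion -/

/-- The transport of a complex along a bijection of the vertex set. -/
def comapEquiv {V W : Type*} (K : AbstractSimplicialComplex V) (e : W ≃ V) :
    AbstractSimplicialComplex W where
  faces := {s | s.map e.toEmbedding ∈ K.faces}
  isRelLowerSet_faces := fun s hs => ⟨Finset.map_nonempty.1 (nonempty_of_mem_faces hs),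
    fun t hts ht => mem_faces_of_subset hs (Finset.map_subset_map.2 hts)
      (Finset.map_nonempty.2 ht)⟩
  singleton_mem w := by
    simpa using K.singleton_mem (e w)

theorem nonempty_homotopyEquiv_comapEquiv {V W : Type*} [Fintype V] [Fintype W]
    (K : AbstractSimplicialComplex V) (e : W ≃ V) :
    Nonempty (ContinuousMap.HomotopyEquiv (K.comapEquiv e).realization K.realization) := by
  classical
  refine nonempty_homotopyEquiv_of_retraction e e.symm e.apply_symm_apply ?_ ?_ ?_
  · intro s hs
    change s.map e.toEmbedding ∈ K.faces at hs
    rwa [Finset.map_eq_image] at hs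
  · intro s hs
    change (s.image e.symm).map e.toEmbedding ∈ K.faces
    rwa [Finset.map_eq_image, Finset.image_image, show (e.toEmbedding ∘ e.symm : V → V) = id from
      funext e.apply_symm_apply, Finset.image_id]
  · intro s hs
    rwa [Finset.image_image, e.symm_comp_self, Finset.image_id, Finset.union_self]

end AbstractSimplicialComplex

theorem theoremB {V : Type*} [Fintype V] (K : AbstractSimplicialComplex V)
    (hK : K.IsConnected) (G : Subgroup K.aut) :
    ∃ (W : Type) (_ : Fintype W) (L : AbstractSimplicialComplex W),
      Nonempty (L.aut ≃* G) ∧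
      Nonempty (ContinuousMap.HomotopyEquiv L.realization K.realization) := by
  obtain ⟨v₀⟩ := hK.nonempty
  let e := (Fintype.equivFin V).symm
  -- The vertex set and the group are replaced by copies in `Type`, since the vertex set of `L` must
  -- live there.
  obtain ⟨W, _, L, ⟨f⟩, ⟨E⟩⟩ := AbstractSimplicialComplex.exists_aut_mulEquiv_homotopyEquiv
    (G := Shrink.{0} G) (K.comapEquiv e) (e.symm v₀)
  obtain ⟨E'⟩ := AbstractSimplicialComplex.nonempty_homotopyEquiv_comapEquiv K e
  exact ⟨W, _, L, ⟨f.trans Shrink.mulEquiv⟩, ⟨E.trans E'⟩⟩
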